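/- Let $\Lambda$ be an Artin algebra, i.e. an algebra that is finitely generated as a module over a commutative artinian ring, and let $\operatorname{mod}\Lambda$ be the category of finitely generated left $\Lambda$-modules. For $M\in\operatorname{mod}\Lambda$, let $\operatorname{pd}M$ (resp. $\operatorname{id}M$) be the least $n\ge 0$ such that $\operatorname{Ext}^j_\Lambda(M,-)=0$ (resp. $\operatorname{Ext}^j_\Lambda(-,M)=0$) on $\operatorname{mod}\Lambda$ for all $j>n$, or $\infty$ if there is none. For a class $\mathcal X\subseteq\operatorname{mod}\Lambda$ put $\operatorname{fin.dim}\mathcal X=\sup\{\operatorname{pd}X: X\in\mathcal X,\ \operatorname{pd}X<\infty\}$. Let $\operatorname{resdim}_{\mathcal X}(M)$ be the least $n\ge 0$ such that there is an exact sequence $0\to X_n\to\cdots\to X_0\to M\to 0$ with all $X_i\in\mathcal X$ (or $\infty$ if there is none), and let $\operatorname{resdim}_{\mathcal X}(\operatorname{mod}\Lambda)=\sup_{M\in\operatorname{mod}\Lambda}\operatorname{resdim}_{\mathcal X}(M)$. Let $\operatorname{add}M$ be the class of direct summands of finite direct sums of copies of $M$, and let $\Omega M$ be the kernel of a projective cover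 of $M$. Let $K$ be the abelian group generated by the isomorphism classes $[M]$ of modules $M\in\operatorname{mod}\Lambda$ with relations $[M]=[X]+[Y]$ whenever $M\cong X\oplus Y$. Let $\langle\mathcal P\rangle\subseteq K$ be the subgroup generated by the classes of the indecomposable projective modules, and let $L$ be the endomorphism of $K/\langle\mathcal P\rangle$ induced by $[M]\mapsto[\Omega M]$. For $M\in\operatorname{mod}\Lambda$ let $\overline{\langle M\rangle}$ be the subgroup of $K/\langle\mathcal P\rangle$ generated by the images of the classes of the indecomposable modules in $\operatorname{add}M$. The Igusa–Todorov functions are defined as follows: $\Phi(M)$ is the least $k\ge 0$ such that $L\colon L^m(\overline{\langle M\rangle})\to L^{m+1}(\overline{\langle M\rangle})$ is an isomorphism for all $m\ge k$, and $\Psi(M)=\Phi(M)+\operatorname{fin.dim}\{Z : Z\text{ is a direct summand of }\Omega^{\Phi(M)}(M)\}$. For a class $\mathcal X\subseteq\operatorname{mod}\Lambda$ put $\Phi\dim\mathcal X=\sup_{X\in\mathcal X}\Phi(X)$ and $\Psi\dim\mathcal X=\sup_{X\in\mathcal X}\Psi(X)$. Write $\operatorname{fin.dim}\Lambda$, $\Phi\dim\Lambda$,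 $\Psi\dim\Lambda$ for the values at $\mathcal X=\operatorname{mod}\Lambda$. Let $T\in\operatorname{mod}\Lambda$ be a cotilting module, i.e. $\operatorname{id}T<\infty$, $\operatorname{Ext}^i_\Lambda(T,T)=0$ for all $i>0$, and $\operatorname{resdim}_{\operatorname{add}T}(I)<\infty$ for every injective $I\in\operatorname{mod}\Lambda$. Let ${}^\perp T=\{M\in\operatorname{mod}\Lambda : \operatorname{Ext}^i_\Lambda(M,T)=0\text{ for all }i\ge 1\}$. Then: (a) $\operatorname{id}(T)=\operatorname{resdim}_{{}^\perp T}(\operatorname{mod}\Lambda)$. (b) $\operatorname{fin.dim}\Lambda\le\Phi\dim\Lambda\le\operatorname{id}(T)+\Phi\dim({}^\perp T)$. (c) If $\Phi\dim({}^\perp T)=0$, then $\operatorname{fin.dim}\Lambda\le\Phi\dim\Lambda\le\Psi\dim\Lambda\le\operatorname{id}(T)$. -/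

import Mathlib

universe u v

noncomputable section

namespace IgusaTodorov

open CategoryTheory

/-! ## Projective covers and syzygies -/

section ProjectiveCovers

variable {Λ : Type u} [Ring Λ]

/-- A submodule `S` of `P` is superfluous if `N + S = P` implies `N = P`. -/
def IsSuperfluous {P : Type v} [AddCommGroup P] [Module Λ P] (S : Submodule Λ P) : Prop :=
  ∀ N : Submodule Λ P, N ⊔ S = ⊤ → N = ⊤

/-- `f : P → M` is a projective cover: `P` is finitely generated projective, `f` is surjective
and its kernel is superfluous. -/
structure IsProjectiveCover {P M : Type u} [AddCommGroup P] [Module Λ P] [AddCommGroup M]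
    [Module Λ M] (f : P →ₗ[Λ] M) : Prop where
  finite : Module.Finite Λ P
  projective : Module.Projective Λ P
  surjective : Function.Surjective f
  superfluous : IsSuperfluous (LinearMap.ker f)

theorem IsSuperfluous.map {P Q : Type u} [AddCommGroup P] [Module Λ P] [AddCommGroup Q]
    [Module Λ Q] {S : Submodule Λ P} (hS : IsSuperfluous S) (φ : P →ₗ[Λ] Q) :
    IsSuperfluous (S.map φ) := by
  intro N hN
  have h1 : N.comap φ ⊔ S = ⊤ := by
    rw [eq_top_iff]
    intro p _
    have hp : φ p ∈ N ⊔ S.map φ := by rw [hN]; trivial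
    obtain ⟨n, hn, t, ht, hnt⟩ := Submodule.mem_sup.1 hp
    obtain ⟨s, hs, rfl⟩ := ht
    refine Submodule.mem_sup.2 ⟨p - s, ?_, s, hs, by abel⟩
    change φ (p - s) ∈ N
    rw [map_sub, ← hnt]
    simpa using hn
  have h2 := hS _ h1
  have h3 : S.map φ ≤ N := by
    rw [Submodule.map_le_iff_le_comap, h2]
    exact le_top
  rwa [sup_eq_left.2 h3] at hN

theorem IsSuperfluous.sup {P : Type u} [AddCommGroup P] [Module Λ P] {S T : Submodule Λ P}
    (hS : IsSuperfluous S) (hT : IsSuperfluous T) : IsSuperfluous (S ⊔ T) := by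
  intro N hN
  rw [← sup_assoc] at hN
  exact hS _ (hT _ hN)

theorem IsProjectiveCover.prod {P Q M N : Type u} [AddCommGroup P] [Module Λ P]
    [AddCommGroup Q] [Module Λ Q] [AddCommGroup M] [Module Λ M] [AddCommGroup N] [Module Λ N]
    {f : P →ₗ[Λ] M} {g : Q →ₗ[Λ] N} (hf : IsProjectiveCover f) (hg : IsProjectiveCover g) :
    IsProjectiveCover (f.prodMap g) := by
  have := hf.finite
  have := hg.finite
  have := hf.projective
  have := hg.projective
  refine ⟨inferInstance, inferInstance, ?_, ?_⟩
  · rintro ⟨m, n⟩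
    obtain ⟨p, rfl⟩ := hf.surjective m
    obtain ⟨q, rfl⟩ := hg.surjective n
    exact ⟨(p, q), rfl⟩
  · have h : LinearMap.ker (f.prodMap g) =
        (LinearMap.ker f).map (LinearMap.inl Λ P Q) ⊔
          (LinearMap.ker g).map (LinearMap.inr Λ P Q) := by
      rw [LinearMap.ker_prodMap, LinearMap.prod_eq_sup_map]
    rw [h]
    exact (hf.superfluous.map _).sup (hg.superfluous.map _)

theorem IsProjectiveCover.comp_equiv {P M N : Type u} [AddCommGroup P] [Module Λ P]
    [AddCommGroup M] [Module Λ M] [AddCommGroup N] [Module Λ N]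
    {f : P →ₗ[Λ] M} (hf : IsProjectiveCover f) (e : M ≃ₗ[Λ] N) :
    IsProjectiveCover (e.toLinearMap ∘ₗ f) := by
  refine ⟨hf.finite, hf.projective, e.surjective.comp hf.surjective, ?_⟩
  rw [LinearEquiv.ker_comp]
  exact hf.superfluous

/-- The kernels of two projective covers of the same module are isomorphic. -/
theorem IsProjectiveCover.ker_equiv {P Q M : Type u} [AddCommGroup P] [Module Λ P]
    [AddCommGroup Q] [Module Λ Q] [AddCommGroup M] [Module Λ M]
    {f : P →ₗ[Λ] M} {g : Q →ₗ[Λ] M} (hf : IsProjectiveCover f) (hg : IsProjectiveCover g) :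
    Nonempty (LinearMap.ker f ≃ₗ[Λ] LinearMap.ker g) := by
  have := hf.projective
  have := hg.projective
  have key : ∀ {A B : Type u} [AddCommGroup A] [Module Λ A] [AddCommGroup B] [Module Λ B]
      {a : A →ₗ[Λ] M} {b : B →ₗ[Λ] M}, Function.Surjective a → IsSuperfluous (LinearMap.ker b) →
      ∀ h : A →ₗ[Λ] B, b ∘ₗ h = a → Function.Surjective h := by
    intro A B _ _ _ _ a b ha hb h hh
    rw [← LinearMap.range_eq_top]
    apply hb
    rw [eq_top_iff]
    intro x _
    obtain ⟨y, hy⟩ := ha (b x)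
    refine Submodule.mem_sup.2 ⟨h y, ⟨y, rfl⟩, x - h y, ?_, by abel⟩
    have : b (h y) = a y := by rw [← hh]; rfl
    rw [LinearMap.mem_ker, map_sub, this, hy, sub_self]
  obtain ⟨h, hh⟩ := Module.projective_lifting_property g f hg.surjective
  have hs : Function.Surjective h := key hf.surjective hg.superfluous h hh
  obtain ⟨s, hsec⟩ := Module.projective_lifting_property h LinearMap.id hs
  have hfs : f ∘ₗ s = g := by
    rw [← hh, LinearMap.comp_assoc, hsec, LinearMap.comp_id]
  have hss : Function.Surjective s := key hg.surjective hf.superfluous s hfs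
  have hsec' : ∀ q, h (s q) = q := fun q => LinearMap.congr_fun hsec q
  have hinj : Function.Injective h := by
    intro x y hxy
    obtain ⟨x', rfl⟩ := hss x
    obtain ⟨y', rfl⟩ := hss y
    rw [hsec', hsec'] at hxy
    rw [hxy]
  let e : P ≃ₗ[Λ] Q := LinearEquiv.ofBijective h ⟨hinj, hs⟩
  have hmap : (LinearMap.ker f).map e.toLinearMap = LinearMap.ker g := by
    ext q
    constructor
    · rintro ⟨p, hp, rfl⟩
      have : g (h p) = f p := LinearMap.congr_fun hh p
      change g (h p) = 0
      rw [this]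
      exact hp
    · intro hq
      obtain ⟨p, rfl⟩ := hs q
      refine ⟨p, ?_, rfl⟩
      have : g (h p) = f p := LinearMap.congr_fun hh p
      change f p = 0
      rw [← this]
      exact hq
  exact ⟨e.ofSubmodules _ _ hmap⟩

/-- Over a left artinian ring every finitely generated module has a projective cover. -/
theorem exists_isProjectiveCover [IsArtinianRing Λ] (M : FGModuleCat.{u} Λ) :
    ∃ (P : FGModuleCat.{u} Λ) (f : P →ₗ[Λ] M), IsProjectiveCover f := by
  obtain ⟨n, π, hπ⟩ := Module.Finite.exists_fin' Λ M
  let S : Set (Submodule Λ (Fin n → Λ)) :=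
    {P | Module.Projective Λ P ∧ Function.Surjective (π.domRestrict P)}
  have hne : S.Nonempty := by
    refine ⟨⊤, Module.Projective.of_equiv (Submodule.topEquiv (R := Λ) (M := Fin n → Λ)).symm, ?_⟩
    intro m
    obtain ⟨x, rfl⟩ := hπ m
    exact ⟨⟨x, trivial⟩, rfl⟩
  obtain ⟨P, ⟨hPp, hPs⟩, hmin⟩ := WellFounded.has_min
    (wellFounded_lt (α := Submodule Λ (Fin n → Λ))) S hne
  let f : P →ₗ[Λ] M := π.domRestrict P
  refine ⟨FGModuleCat.of Λ P, f, inferInstance, hPp, hPs, ?_⟩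
  intro N hN
  have : Module.Projective Λ P := hPp
  have hfN : Function.Surjective (f ∘ₗ N.subtype) := by
    intro m
    obtain ⟨p, rfl⟩ := hPs m
    have hp : p ∈ N ⊔ LinearMap.ker f := by rw [hN]; trivial
    obtain ⟨a, ha, b, hb, rfl⟩ := Submodule.mem_sup.1 hp
    refine ⟨⟨a, ha⟩, ?_⟩
    have hb' : f b = 0 := hb
    change f a = f (a + b)
    rw [map_add, hb', add_zero]
  obtain ⟨g, hg⟩ := Module.projective_lifting_property (f ∘ₗ N.subtype) f hfN
  let e : Module.End Λ P := N.subtype ∘ₗ g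
  have hfe : ∀ x, f (e x) = f x := fun x => LinearMap.congr_fun hg x
  have hfek : ∀ (k : ℕ) (x : P), f ((e ^ k) x) = f x := by
    intro k
    induction k with
    | zero => intro x; rfl
    | succ k ih =>
      intro x
      rw [pow_succ, Module.End.mul_apply, ih, hfe]
  obtain ⟨k, hk, hk1⟩ := ((LinearMap.eventually_isCompl_ker_pow_range_pow e).and
    (Filter.eventually_ge_atTop 1)).exists
  obtain ⟨j, rfl⟩ : ∃ j, k = j + 1 := ⟨k - 1, by omega⟩
  have hrN : LinearMap.range (e ^ (j + 1)) ≤ N := by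
    rintro _ ⟨x, rfl⟩
    rw [pow_succ', Module.End.mul_apply]
    exact (g ((e ^ j) x)).2
  let r : Submodule Λ P := LinearMap.range (e ^ (j + 1))
  have hrproj : Module.Projective Λ r := by
    refine Module.Projective.of_split r.subtype
      (Submodule.projectionOnto r _ hk.symm) ?_
    ext x
    simp
  let Q : Submodule Λ (Fin n → Λ) := r.map P.subtype
  have hQ : Q ∈ S := by
    refine ⟨Module.Projective.of_equiv (Submodule.equivMapOfInjective P.subtype
      P.injective_subtype r), ?_⟩
    intro m
    obtain ⟨p, rfl⟩ := hPs m
    exact ⟨⟨_, Submodule.mem_map_of_mem (f := P.subtype) (p := r) ⟨p, rfl⟩⟩, hfek (j + 1) p⟩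
  have hQP : Q = P := by
    have hle : Q ≤ P := by
      rintro _ ⟨x, _, rfl⟩
      exact x.2
    by_contra hne'
    exact hmin Q hQ (lt_of_le_of_ne hle hne')
  rw [eq_top_iff]
  intro p _
  have hp : (p : Fin n → Λ) ∈ Q := by rw [hQP]; exact p.2
  obtain ⟨x, hx, hxp⟩ := hp
  have : x = p := Subtype.ext hxp
  exact hrN (this ▸ hx)

end ProjectiveCovers

section ModCategory

variable {Λ : Type u} [Ring Λ]

/-! ## Direct sums, `add`, indecomposable modules

A class of objects of `mod Λ` is a `Set (FGModuleCat Λ)`. -/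

/-- `Z` is (isomorphic to) a direct summand of `M`. -/
def IsSummand (Z M : FGModuleCat.{u} Λ) : Prop :=
  ∃ Z' : FGModuleCat.{u} Λ, Nonempty (M ≃ₗ[Λ] (Z × Z'))

/-- `add M`: the direct summands of the finite direct sums of copies of `M`. -/
def addClosure (M : FGModuleCat.{u} Λ) : Set (FGModuleCat.{u} Λ) :=
  {Z | ∃ n : ℕ, IsSummand Z (FGModuleCat.of Λ (Fin n → M))}

/-- Indecomposable modules: nonzero, and not a direct sum of two nonzero modules. -/
def IsIndecomposable (M : FGModuleCat.{u} Λ) : Prop :=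
  Nontrivial M ∧ ∀ X Y : FGModuleCat.{u} Λ, Nonempty (M ≃ₗ[Λ] (X × Y)) →
    Subsingleton X ∨ Subsingleton Y

/-! ## Homological dimensions -/

/-- The projective dimension: the least `n` with `Ext^j(M, -) = 0` on `mod Λ` for all `j > n`
(`⊤` if there is none). -/
def pd (M : FGModuleCat.{u} Λ) : ℕ∞ :=
  ⨅ (n : ℕ) (_ : ∀ j : ℕ, n < j → ∀ N : FGModuleCat.{u} Λ,
    Subsingleton (Abelian.Ext M.obj N.obj j)), (n : ℕ∞)

/-- The injective dimension: the least `n` with `Ext^j(-, M) = 0` on `mod Λ` for all `j > n`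
(`⊤` if there is none). -/
def injDim (M : FGModuleCat.{u} Λ) : ℕ∞ :=
  ⨅ (n : ℕ) (_ : ∀ j : ℕ, n < j → ∀ N : FGModuleCat.{u} Λ,
    Subsingleton (Abelian.Ext N.obj M.obj j)), (n : ℕ∞)

/-- The finitistic dimension of a class: the supremum of the finite projective dimensions. -/
def finDim (𝒳 : Set (FGModuleCat.{u} Λ)) : ℕ∞ :=
  ⨆ (X : FGModuleCat.{u} Λ) (_ : X ∈ 𝒳 ∧ pd X < ⊤), pd X

/-- `HasResolution 𝒳 n M`: there is an exact sequence `0 → X_n → ⋯ → X_1 → X_0 → M → 0` with all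
`X_i` in `𝒳`. For `n + 1` it is spliced from `0 → K → X_0 → M → 0` and such a sequence for `K`. -/
def HasResolution (𝒳 : Set (FGModuleCat.{u} Λ)) : ℕ → FGModuleCat.{u} Λ → Prop
  | 0, M => ∃ X ∈ 𝒳, Nonempty (X ≃ₗ[Λ] M)
  | n + 1, M => ∃ X ∈ 𝒳, ∃ (K : FGModuleCat.{u} Λ) (i : K →ₗ[Λ] X) (p : X →ₗ[Λ] M),
      Function.Injective i ∧ Function.Exact i p ∧ Function.Surjective p ∧ HasResolution 𝒳 n K

/-- The `𝒳`-resolution dimension of a module. -/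
def resDim (𝒳 : Set (FGModuleCat.{u} Λ)) (M : FGModuleCat.{u} Λ) : ℕ∞ :=
  ⨅ (n : ℕ) (_ : HasResolution 𝒳 n M), (n : ℕ∞)

/-- The `𝒳`-resolution dimension of a class of modules. -/
def resDimClass (𝒳 𝒴 : Set (FGModuleCat.{u} Λ)) : ℕ∞ :=
  ⨆ (Y : FGModuleCat.{u} Λ) (_ : Y ∈ 𝒴), resDim 𝒳 Y

/-- The left orthogonal class `{M | Ext^i(M, T) = 0 for all i ≥ 1}` in `mod Λ`. -/
def leftPerp (T : FGModuleCat.{u} Λ) : Set (FGModuleCat.{u} Λ) :=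
  {M | ∀ i : ℕ, 1 ≤ i → Subsingleton (Abelian.Ext M.obj T.obj i)}

/-- Cotilting modules: finite injective dimension, no self-extensions, and every finitely generated
injective module has a finite resolution by modules in `add T`. -/
structure IsCotilting (T : FGModuleCat.{u} Λ) : Prop where
  injDim_lt_top : injDim T < ⊤
  ext_self : ∀ i : ℕ, 0 < i → Subsingleton (Abelian.Ext T.obj T.obj i)
  resDim_injective : ∀ I : FGModuleCat.{u} Λ, Module.Injective Λ I → resDim (addClosure T) I < ⊤

end ModCategory

/-! ## The split Grothendieck group of `mod Λ` -/

section SplitGroup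

variable (Λ : Type u) [Ring Λ]

/-- The relations `[M] - [X] - [Y]` for `M ≅ X ⊕ Y`. -/
def splitRelations : AddSubgroup (FreeAbelianGroup (FGModuleCat.{u} Λ)) :=
  AddSubgroup.closure {r | ∃ M X Y : FGModuleCat.{u} Λ, Nonempty (M ≃ₗ[Λ] (X × Y)) ∧
    r = FreeAbelianGroup.of M - FreeAbelianGroup.of X - FreeAbelianGroup.of Y}

/-- The group `K`: generators `[M]` for `M` in `mod Λ`, relations `[M] = [X] + [Y]` for
`M ≅ X ⊕ Y`. (Isomorphic modules are identified: take `Y = 0`.) -/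
abbrev SplitK : Type (u + 1) := FreeAbelianGroup (FGModuleCat.{u} Λ) ⧸ splitRelations Λ

variable {Λ}

/-- The class `[M]` in `K`. -/
def cls (M : FGModuleCat.{u} Λ) : SplitK Λ :=
  QuotientAddGroup.mk (FreeAbelianGroup.of M)

theorem cls_eq_add {M X Y : FGModuleCat.{u} Λ} (h : Nonempty (M ≃ₗ[Λ] (X × Y))) :
    cls M = cls X + cls Y := by
  have hm : FreeAbelianGroup.of M - FreeAbelianGroup.of X - FreeAbelianGroup.of Y ∈
      splitRelations Λ := AddSubgroup.subset_closure ⟨M, X, Y, h, rfl⟩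
  have h0 := (QuotientAddGroup.eq_zero_iff _).2 hm
  rw [QuotientAddGroup.mk_sub, QuotientAddGroup.mk_sub, sub_sub, sub_eq_zero] at h0
  exact h0

theorem cls_eq_zero (X : FGModuleCat.{u} Λ) [Subsingleton X] : cls X = 0 := by
  have h : cls X = cls X + cls X :=
    cls_eq_add ⟨LinearEquiv.ofBijective (0 : X →ₗ[Λ] X × X)
      ⟨fun _ _ _ => Subsingleton.elim _ _, fun y => ⟨0, Subsingleton.elim _ _⟩⟩⟩
  simpa using h

theorem cls_eq_of_equiv {M N : FGModuleCat.{u} Λ} (e : M ≃ₗ[Λ] N) : cls M = cls N := by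
  have h : cls M = cls N + cls (FGModuleCat.of Λ PUnit.{u + 1}) :=
    cls_eq_add ⟨e.trans (LinearEquiv.prodUnique (R := Λ) (M := N) (M₂ := PUnit.{u + 1})).symm⟩
  have : Subsingleton (FGModuleCat.of Λ PUnit.{u + 1}) :=
    inferInstanceAs (Subsingleton PUnit.{u + 1})
  rw [cls_eq_zero (FGModuleCat.of Λ PUnit.{u + 1}), add_zero] at h
  exact h

/-- `⟨𝒳⟩`: the subgroup of `K` generated by the classes of the indecomposable modules which lie
in `𝒳` or are projective. -/
def spanClass (𝒳 : Set (FGModuleCat.{u} Λ)) : AddSubgroup (SplitK Λ) :=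
  AddSubgroup.closure {k | ∃ X : FGModuleCat.{u} Λ,
    IsIndecomposable X ∧ (X ∈ 𝒳 ∨ Module.Projective Λ X) ∧ k = cls X}

/-- The class of the projective modules in `mod Λ`. -/
def projectives (Λ : Type u) [Ring Λ] : Set (FGModuleCat.{u} Λ) :=
  {P | Module.Projective Λ P}

end SplitGroup

/-! ## The syzygy operator and the Igusa-Todorov functions -/

section Functions

variable {Λ : Type u} [Ring Λ] [IsArtinianRing Λ]

/-- A projective cover of `M`. -/
def projCover (M : FGModuleCat.{u} Λ) : FGModuleCat.{u} Λ :=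
  (exists_isProjectiveCover M).choose

/-- The map from the projective cover of `M` onto `M`. -/
def projCoverMap (M : FGModuleCat.{u} Λ) : projCover M →ₗ[Λ] M :=
  (exists_isProjectiveCover M).choose_spec.choose

theorem isProjectiveCover_projCoverMap (M : FGModuleCat.{u} Λ) :
    IsProjectiveCover (projCoverMap M) :=
  (exists_isProjectiveCover M).choose_spec.choose_spec

/-- The syzygy `Ω M`: the kernel of the projective cover of `M`. -/
def syzygy (M : FGModuleCat.{u} Λ) : FGModuleCat.{u} Λ :=
  FGModuleCat.of Λ (LinearMap.ker (projCoverMap M))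

/-- The kernel of any projective cover of `M` is isomorphic to `Ω M`. -/
theorem syzygy_equiv {M : FGModuleCat.{u} Λ} {P : Type u} [AddCommGroup P] [Module Λ P]
    {f : P →ₗ[Λ] M} (hf : IsProjectiveCover f) : Nonempty (syzygy M ≃ₗ[Λ] LinearMap.ker f) :=
  (isProjectiveCover_projCoverMap M).ker_equiv hf

theorem syzygy_prod {M X Y : FGModuleCat.{u} Λ} (h : Nonempty (M ≃ₗ[Λ] (X × Y))) :
    Nonempty (syzygy M ≃ₗ[Λ] (syzygy X × syzygy Y)) := by
  obtain ⟨e⟩ := h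
  have hc := ((isProjectiveCover_projCoverMap X).prod
    (isProjectiveCover_projCoverMap Y)).comp_equiv e.symm
  obtain ⟨e₁⟩ := syzygy_equiv (M := M) hc
  have hk : LinearMap.ker (e.symm.toLinearMap ∘ₗ (projCoverMap X).prodMap (projCoverMap Y)) =
      (LinearMap.ker (projCoverMap X)).prod (LinearMap.ker (projCoverMap Y)) := by
    rw [LinearEquiv.ker_comp, LinearMap.ker_prodMap]
  have e₂ : (LinearMap.ker (projCoverMap X)).prod (LinearMap.ker (projCoverMap Y)) ≃ₗ[Λ]
      (LinearMap.ker (projCoverMap X) × LinearMap.ker (projCoverMap Y)) :=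
    { toFun := fun z => (⟨z.1.1, z.2.1⟩, ⟨z.1.2, z.2.2⟩)
      invFun := fun z => ⟨(z.1.1, z.2.1), ⟨z.1.2, z.2.2⟩⟩
      map_add' := fun _ _ => rfl
      map_smul' := fun _ _ => rfl
      left_inv := fun _ => rfl
      right_inv := fun _ => rfl }
  exact ⟨(e₁.trans (LinearEquiv.ofEq _ _ hk)).trans e₂⟩

theorem subsingleton_syzygy (P : FGModuleCat.{u} Λ) (hP : Module.Projective Λ P) :
    Subsingleton (syzygy P) := by
  have hc : IsProjectiveCover (LinearMap.id : P →ₗ[Λ] P) := by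
    refine ⟨inferInstance, hP, Function.surjective_id, ?_⟩
    intro N hN
    rwa [LinearMap.ker_id, sup_bot_eq] at hN
  obtain ⟨e⟩ := syzygy_equiv (M := P) hc
  have : Subsingleton (LinearMap.ker (LinearMap.id : P →ₗ[Λ] P)) := by
    rw [LinearMap.ker_id]
    infer_instance
  exact e.toEquiv.subsingleton

variable (Λ)

/-- The endomorphism `L` of `K` with `L [M] = [Ω M]`. -/
def syzygyHom : SplitK Λ →+ SplitK Λ :=
  QuotientAddGroup.lift (splitRelations Λ)
    (FreeAbelianGroup.lift fun M : FGModuleCat.{u} Λ => cls (syzygy M)) (by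
      refine (AddSubgroup.closure_le _).2 ?_
      rintro _ ⟨M, X, Y, h, rfl⟩
      change FreeAbelianGroup.lift _ _ = 0
      rw [map_sub, map_sub, FreeAbelianGroup.lift_apply_of, FreeAbelianGroup.lift_apply_of,
        FreeAbelianGroup.lift_apply_of, cls_eq_add (syzygy_prod h)]
      abel)

theorem syzygyHom_cls (M : FGModuleCat.{u} Λ) : syzygyHom Λ (cls M) = cls (syzygy M) :=
  FreeAbelianGroup.lift_apply_of _ _

/-- The group `K/⟨𝒫⟩`, where `𝒫` is the class of projective modules. -/
abbrev StableK : Type (u + 1) := SplitK Λ ⧸ spanClass (projectives Λ)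

/-- The endomorphism of `K/⟨𝒫⟩` induced by `L`. -/
def stableSyzygyHom : StableK Λ →+ StableK Λ :=
  QuotientAddGroup.map _ _ (syzygyHom Λ) (by
    refine (AddSubgroup.closure_le _).2 ?_
    rintro _ ⟨X, _, hX, rfl⟩
    have hX' : Module.Projective Λ X := hX.elim (fun h => h) (fun h => h)
    have := subsingleton_syzygy X hX'
    change syzygyHom Λ (cls X) ∈ spanClass (projectives Λ)
    rw [syzygyHom_cls, cls_eq_zero]
    exact zero_mem _)

variable {Λ}

/-- The Fitting number `η_f(X)`: the least `k` such that `f : f^m(X) → f^{m+1}(X)` is bijective for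
all `m ≥ k`. It exists for finitely generated `X` by Fitting's lemma. -/
def fittingNumber {G : Type v} [AddCommGroup G] (f : G →+ G) (X : AddSubgroup G) : ℕ :=
  sInf {k : ℕ | ∀ m : ℕ, k ≤ m →
    Set.BijOn f (f^[m] '' (X : Set G)) (f^[m + 1] '' (X : Set G))}

/-- The Igusa-Todorov function `Φ`: the Fitting number, for the endomorphism of `K/⟨𝒫⟩` induced by
`Ω`, of the image of `⟨add M⟩`. -/
def Phi (M : FGModuleCat.{u} Λ) : ℕ :=
  fittingNumber (stableSyzygyHom Λ)
    ((spanClass (addClosure M)).map (QuotientAddGroup.mk' (spanClass (projectives Λ))))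

/-- The Igusa-Todorov function `Ψ(M) = Φ(M) + fin.dim {Z : Z is a summand of Ω^{Φ(M)} M}`. -/
def Psi (M : FGModuleCat.{u} Λ) : ℕ∞ :=
  Phi M + finDim {Z | IsSummand Z (syzygy^[Phi M] M)}

/-- The `Φ`-dimension of a class of modules. -/
def PhiDim (𝒳 : Set (FGModuleCat.{u} Λ)) : ℕ∞ :=
  ⨆ (X : FGModuleCat.{u} Λ) (_ : X ∈ 𝒳), (Phi X : ℕ∞)

/-- The `Ψ`-dimension of a class of modules. -/
def PsiDim (𝒳 : Set (FGModuleCat.{u} Λ)) : ℕ∞ :=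
  ⨆ (X : FGModuleCat.{u} Λ) (_ : X ∈ 𝒳), Psi X

end Functions

end IgusaTodorov

end

open IgusaTodorov

/-! Parts (a) to (c) rest on dimension shifting. If `injDim T = n`, then `Ext^j(Ω^n M, T) =
Ext^(j+n)(M, T) = 0` for `j ≥ 1`, so `Ω^n M` lies in `leftPerp T` for every `M`. A projective
resolution truncated there is a resolution by `leftPerp T`; conversely, a `leftPerp T`-resolution of
length `n` kills `Ext^j(-, T)` for `j > n`. This is (a), `injDim_eq_resDimClass`.

For (b), `L` sends `⟨add M⟩` into `⟨add ΩM⟩`, so `Φ(M) ≤ Φ(ΩM) + 1`, and iterating `n` times gives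
the upper bound (`Phi_le_injDim_add`). The lower bound is `pd_le_Phi`: if `pd M = j + 1`, then `L`
kills `[Ω^j M] ≠ 0`, so `L` is not injective on `L^j⟨add M⟩`. For (c), write `n = Φ(M) + d`. A
summand `Z` of `Ω^Φ(M) M` has `Ω^d Z` in `leftPerp T`; if `pd Z` is finite, then `pd (Ω^d Z) ≤ Φ(Ω^d
Z) = 0`, so `pd Z ≤ d` (`Psi_le_injDim`).

Two facts underlie `Φ`. A class is zero in `K/⟨𝒫⟩` only for projective modules, and `⟨add M⟩` is
finitely generated, so that Fitting's lemma applies. Both come from Krull–Schmidt multiplicities: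
`mult X` is additive and detects the indecomposable `X` among indecomposables. -/

namespace IgusaTodorov

open CategoryTheory

/-! ### Vanishing of Ext along short exact sequences -/

section ExtVanishing

variable {Λ : Type u} [Ring Λ]

/-- The short exact sequence in `ModuleCat Λ` given by linear maps. -/
theorem shortExact_of_linearMap {K X M : FGModuleCat.{u} Λ} {i : K →ₗ[Λ] X} {p : X →ₗ[Λ] M}
    (hi : Function.Injective i) (hip : Function.Exact i p) (hp : Function.Surjective p) :
    (ShortComplex.mk (X₁ := K.obj) (X₂ := X.obj) (X₃ := M.obj) (ModuleCat.ofHom i)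
      (ModuleCat.ofHom p) (by ext x; exact hip.apply_apply_eq_zero x)).ShortExact :=
  ModuleCat.shortComplex_shortExact _ hip hi hp

theorem subsingleton_ext_of_kernel {K X M N : FGModuleCat.{u} Λ} {i : K →ₗ[Λ] X}
    {p : X →ₗ[Λ] M} (hi : Function.Injective i) (hip : Function.Exact i p)
    (hp : Function.Surjective p) {j : ℕ} (hK : Subsingleton (Abelian.Ext K.obj N.obj j))
    (hX : Subsingleton (Abelian.Ext X.obj N.obj (j + 1))) :
    Subsingleton (Abelian.Ext M.obj N.obj (j + 1)) := by
  refine subsingleton_of_forall_eq 0 fun x => ?_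
  obtain ⟨y, rfl⟩ := Abelian.Ext.contravariant_sequence_exact₃
    (shortExact_of_linearMap hi hip hp) N.obj x
      (Subsingleton.elim (α := Abelian.Ext X.obj N.obj (j + 1)) _ _) (add_comm 1 j)
  rw [Subsingleton.elim (α := Abelian.Ext K.obj N.obj j) y 0, Abelian.Ext.comp_zero]

theorem subsingleton_ext_kernel {K X M N : FGModuleCat.{u} Λ} {i : K →ₗ[Λ] X}
    {p : X →ₗ[Λ] M} (hi : Function.Injective i) (hip : Function.Exact i p)
    (hp : Function.Surjective p) {j : ℕ} (hX : Subsingleton (Abelian.Ext X.obj N.obj j))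
    (hM : Subsingleton (Abelian.Ext M.obj N.obj (j + 1))) :
    Subsingleton (Abelian.Ext K.obj N.obj j) := by
  refine subsingleton_of_forall_eq 0 fun x => ?_
  obtain ⟨y, rfl⟩ := Abelian.Ext.contravariant_sequence_exact₁
    (shortExact_of_linearMap hi hip hp) N.obj x (add_comm 1 j)
      (Subsingleton.elim (α := Abelian.Ext M.obj N.obj (j + 1)) _ _)
  rw [Subsingleton.elim (α := Abelian.Ext X.obj N.obj j) y 0, Abelian.Ext.comp_zero]

theorem subsingleton_ext_of_projective {P : FGModuleCat.{u} Λ} (hP : Module.Projective Λ P)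
    (N : FGModuleCat.{u} Λ) {j : ℕ} (hj : 0 < j) : Subsingleton (Abelian.Ext P.obj N.obj j) := by
  have : Projective P.obj := (IsProjective.iff_projective P).1 hP
  obtain ⟨j, rfl⟩ : ∃ i, j = i + 1 := ⟨j - 1, by omega⟩
  exact subsingleton_of_forall_eq 0 Abelian.Ext.eq_zero_of_projective

theorem subsingleton_ext_of_retract {Z M N : FGModuleCat.{u} Λ} (s : Z →ₗ[Λ] M) (r : M →ₗ[Λ] Z)
    (hrs : r ∘ₗ s = LinearMap.id) {j : ℕ} (hM : Subsingleton (Abelian.Ext M.obj N.obj j)) :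
    Subsingleton (Abelian.Ext Z.obj N.obj j) := by
  refine subsingleton_of_forall_eq 0 fun x => ?_
  have h : (ModuleCat.ofHom s : Z.obj ⟶ M.obj) ≫ (ModuleCat.ofHom r : M.obj ⟶ Z.obj) = 𝟙 _ := by
    ext y
    exact LinearMap.congr_fun hrs y
  rw [← Abelian.Ext.mk₀_id_comp x, ← h, ← Abelian.Ext.mk₀_comp_mk₀_assoc,
    Subsingleton.elim (α := Abelian.Ext M.obj N.obj j)
      ((Abelian.Ext.mk₀ (ModuleCat.ofHom r)).comp x (zero_add j)) 0, Abelian.Ext.comp_zero]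

theorem IsSummand.exists_retract {Z M : FGModuleCat.{u} Λ} (h : IsSummand Z M) :
    ∃ (s : Z →ₗ[Λ] M) (r : M →ₗ[Λ] Z), r ∘ₗ s = LinearMap.id := by
  obtain ⟨Z', ⟨e⟩⟩ := h
  refine ⟨e.symm.toLinearMap ∘ₗ LinearMap.inl Λ Z Z', LinearMap.fst Λ Z Z' ∘ₗ e.toLinearMap, ?_⟩
  ext x
  simp

/-- The obstruction to lifting `𝟙 M` through `p` lies in `Ext^1(M, K)`; a lift splits `p`. -/
theorem projective_of_subsingleton_ext {K P M : FGModuleCat.{u} Λ} (hP : Module.Projective Λ P)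
    {i : K →ₗ[Λ] P} {p : P →ₗ[Λ] M} (hi : Function.Injective i) (hip : Function.Exact i p)
    (hp : Function.Surjective p) (h : Subsingleton (Abelian.Ext M.obj K.obj 1)) :
    Module.Projective Λ M := by
  obtain ⟨x, hx⟩ := Abelian.Ext.covariant_sequence_exact₃ M.obj
    (shortExact_of_linearMap hi hip hp) (Abelian.Ext.mk₀ (𝟙 M.obj)) (zero_add 1)
    (Subsingleton.elim (α := Abelian.Ext M.obj K.obj 1) _ _)
  obtain ⟨s, rfl⟩ := (Abelian.Ext.mk₀_bijective (X := M.obj) (Y := P.obj)).2 x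
  rw [Abelian.Ext.mk₀_comp_mk₀] at hx
  have hs := (Abelian.Ext.mk₀_bijective (X := M.obj) (Y := M.obj)).1 hx
  refine Module.Projective.of_split s.hom p ?_
  ext y
  exact congrArg (fun f : M.obj ⟶ M.obj => f.hom y) hs

/-- The admissible bounds are upward closed, so an infimum at most `k` makes `k` itself admissible.
-/
theorem pd_le_iff {M : FGModuleCat.{u} Λ} {k : ℕ} : pd M ≤ k ↔
    ∀ j : ℕ, k < j → ∀ N : FGModuleCat.{u} Λ, Subsingleton (Abelian.Ext M.obj N.obj j) := by
  refine ⟨fun h => ?_, fun h => iInf₂_le k h⟩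
  by_contra hk
  have : ((k + 1 : ℕ) : ℕ∞) ≤ pd M := by
    refine le_iInf₂ fun n hn => ?_
    by_contra hlt
    refine hk fun j hj => hn j ?_
    rw [Nat.cast_le] at hlt
    omega
  have := this.trans h
  rw [Nat.cast_le] at this
  omega

theorem injDim_le_iff {M : FGModuleCat.{u} Λ} {k : ℕ} : injDim M ≤ k ↔
    ∀ j : ℕ, k < j → ∀ N : FGModuleCat.{u} Λ, Subsingleton (Abelian.Ext N.obj M.obj j) := by
  refine ⟨fun h => ?_, fun h => iInf₂_le k h⟩
  by_contra hk
  have : ((k + 1 : ℕ) : ℕ∞) ≤ injDim M := by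
    refine le_iInf₂ fun n hn => ?_
    by_contra hlt
    refine hk fun j hj => hn j ?_
    rw [Nat.cast_le] at hlt
    omega
  have := this.trans h
  rw [Nat.cast_le] at this
  omega

/-- Lengths of resolutions need not be upward closed, since `𝒳` need not contain zero modules; hence
`n ≤ k` instead of `k` itself. -/
theorem exists_hasResolution_of_resDim_le {𝒳 : Set (FGModuleCat.{u} Λ)} {M : FGModuleCat.{u} Λ}
    {k : ℕ} (h : resDim 𝒳 M ≤ k) : ∃ n ≤ k, HasResolution 𝒳 n M := by
  by_contra! hk
  have : ((k + 1 : ℕ) : ℕ∞) ≤ resDim 𝒳 M := by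
    refine le_iInf₂ fun n hn => ?_
    by_contra hlt
    rw [Nat.cast_le] at hlt
    exact hk n (by omega) hn
  have := this.trans h
  rw [Nat.cast_le] at this
  omega

theorem HasResolution.subsingleton_ext {T : FGModuleCat.{u} Λ} {n : ℕ} {M : FGModuleCat.{u} Λ}
    (h : HasResolution (leftPerp T) n M) {j : ℕ} (hj : n < j) :
    Subsingleton (Abelian.Ext M.obj T.obj j) := by
  induction n generalizing M j with
  | zero =>
    obtain ⟨X, hX, ⟨e⟩⟩ := h
    refine subsingleton_ext_of_retract e.symm.toLinearMap e.toLinearMap ?_ (hX j hj)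
    ext x
    simp
  | succ n ih =>
    obtain ⟨X, hX, K, i, p, hi, hip, hp, hK⟩ := h
    obtain ⟨j, rfl⟩ : ∃ i, j = i + 1 := ⟨j - 1, by omega⟩
    exact subsingleton_ext_of_kernel hi hip hp (ih hK (by omega)) (hX _ (by omega))

theorem leftPerp_of_isSummand {T Z M : FGModuleCat.{u} Λ} (h : IsSummand Z M)
    (hM : M ∈ leftPerp T) : Z ∈ leftPerp T := by
  obtain ⟨s, r, hrs⟩ := h.exists_retract
  exact fun j hj => subsingleton_ext_of_retract s r hrs (hM j hj)

theorem projectives_subset_leftPerp (T : FGModuleCat.{u} Λ) : projectives Λ ⊆ leftPerp T :=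
  fun _ hP _ hj => subsingleton_ext_of_projective hP T hj

end ExtVanishing

/-! ### Dimension shifting by syzygies, and part (a) -/

section Syzygies

variable {Λ : Type u} [Ring Λ] [IsArtinianRing Λ]

theorem syzygy_exact (M : FGModuleCat.{u} Λ) :
    ∃ i : syzygy M →ₗ[Λ] projCover M, Function.Injective i ∧
      Function.Exact i (projCoverMap M) ∧ Function.Surjective (projCoverMap M) :=
  ⟨(LinearMap.ker (projCoverMap M)).subtype, Submodule.injective_subtype _,
    LinearMap.exact_subtype_ker_map _, (isProjectiveCover_projCoverMap M).surjective⟩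

/-- The middle term is projective, so its Ext groups vanish in positive degrees; `0 < j` is there
because `Ext^0` of a projective is a Hom group. -/
theorem subsingleton_ext_syzygy_iff {M N : FGModuleCat.{u} Λ} {j : ℕ} (hj : 0 < j) :
    Subsingleton (Abelian.Ext (syzygy M).obj N.obj j) ↔
      Subsingleton (Abelian.Ext M.obj N.obj (j + 1)) := by
  obtain ⟨i, hi, hip, hp⟩ := syzygy_exact M
  have hP := (isProjectiveCover_projCoverMap M).projective
  exact ⟨fun h => subsingleton_ext_of_kernel hi hip hp h
      (subsingleton_ext_of_projective hP N j.succ_pos),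
    fun h => subsingleton_ext_kernel hi hip hp (subsingleton_ext_of_projective hP N hj) h⟩

theorem pd_le_succ_iff {M : FGModuleCat.{u} Λ} {k : ℕ} :
    pd M ≤ (k + 1 : ℕ) ↔ pd (syzygy M) ≤ k := by
  rw [pd_le_iff, pd_le_iff]
  refine ⟨fun h j hj N => (subsingleton_ext_syzygy_iff (by omega)).2 (h _ (by omega) N),
    fun h j hj N => ?_⟩
  obtain ⟨j, rfl⟩ : ∃ i, j = i + 1 := ⟨j - 1, by omega⟩
  exact (subsingleton_ext_syzygy_iff (by omega)).1 (h _ (by omega) N)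

theorem pd_le_zero_iff {M : FGModuleCat.{u} Λ} :
    pd M ≤ (0 : ℕ) ↔ Module.Projective Λ M := by
  rw [pd_le_iff]
  refine ⟨fun h => ?_, fun h j hj N => subsingleton_ext_of_projective h N hj⟩
  obtain ⟨i, hi, hip, hp⟩ := syzygy_exact M
  -- The single test module `syzygy M` suffices.
  exact projective_of_subsingleton_ext (isProjectiveCover_projCoverMap M).projective hi hip hp
    (h 1 one_pos _)

theorem pd_le_iff_projective_syzygy {M : FGModuleCat.{u} Λ} {k : ℕ} :
    pd M ≤ k ↔ Module.Projective Λ (syzygy^[k] M) := by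
  induction k generalizing M with
  | zero => exact pd_le_zero_iff
  | succ k ih => rw [pd_le_succ_iff, ih, Function.iterate_succ_apply]

theorem iterate_syzygy_mem_leftPerp {T : FGModuleCat.{u} Λ} {n : ℕ} {M : FGModuleCat.{u} Λ}
    (h : ∀ j, n < j → Subsingleton (Abelian.Ext M.obj T.obj j)) :
    syzygy^[n] M ∈ leftPerp T := by
  induction n generalizing M with
  | zero => exact fun j hj => h j hj
  | succ n ih =>
    exact ih fun j hj => (subsingleton_ext_syzygy_iff (by omega)).2 (h _ (by omega))

/-- Projective covers supply the terms in degrees below `n`, and the `n`-th syzygy is the last term.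
-/
theorem hasResolution_of_iterate_syzygy {𝒳 : Set (FGModuleCat.{u} Λ)}
    (h𝒳 : projectives Λ ⊆ 𝒳) {n : ℕ} {M : FGModuleCat.{u} Λ} (h : syzygy^[n] M ∈ 𝒳) :
    HasResolution 𝒳 n M := by
  induction n generalizing M with
  | zero => exact ⟨M, h, ⟨LinearEquiv.refl Λ M⟩⟩
  | succ n ih =>
    obtain ⟨i, hi, hip, hp⟩ := syzygy_exact M
    exact ⟨projCover M, h𝒳 (isProjectiveCover_projCoverMap M).projective, syzygy M, i,
      projCoverMap M, hi, hip, hp, ih h⟩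

/-- The injective dimension of `T` is the resolution dimension of `mod Λ` by `leftPerp T`. -/
theorem injDim_eq_resDimClass (T : FGModuleCat.{u} Λ) :
    injDim T = resDimClass (leftPerp T) Set.univ := by
  apply le_antisymm
  · rcases eq_or_ne (resDimClass (leftPerp T) Set.univ) ⊤ with h | h
    · rw [h]
      exact le_top
    obtain ⟨m, hm⟩ := ENat.ne_top_iff_exists.1 h
    rw [← hm, injDim_le_iff]
    intro j hj N
    have hN : resDim (leftPerp T) N ≤ m := by
      rw [hm]
      exact le_iSup₂ (f := fun (Y : FGModuleCat.{u} Λ) (_ : Y ∈ Set.univ) =>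
        resDim (leftPerp T) Y) N trivial
    obtain ⟨n, hn, hres⟩ := exists_hasResolution_of_resDim_le hN
    exact hres.subsingleton_ext (by omega)
  · rcases eq_or_ne (injDim T) ⊤ with h | h
    · rw [h]
      exact le_top
    obtain ⟨n, hn⟩ := ENat.ne_top_iff_exists.1 h
    rw [← hn]
    exact iSup₂_le fun M _ => iInf₂_le n (hasResolution_of_iterate_syzygy
      (projectives_subset_leftPerp T)
      (iterate_syzygy_mem_leftPerp fun j hj => injDim_le_iff.1 hn.ge j hj M))

theorem IsSummand.syzygy {Z M : FGModuleCat.{u} Λ} (h : IsSummand Z M) :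
    IsSummand (syzygy Z) (syzygy M) := by
  obtain ⟨Z', he⟩ := h
  exact ⟨IgusaTodorov.syzygy Z', syzygy_prod he⟩

theorem IsSummand.iterate_syzygy {Z M : FGModuleCat.{u} Λ} (h : IsSummand Z M) (n : ℕ) :
    IsSummand (IgusaTodorov.syzygy^[n] Z) (IgusaTodorov.syzygy^[n] M) := by
  induction n generalizing Z M with
  | zero => exact h
  | succ n ih => exact ih h.syzygy

end Syzygies

/-! ### Multiplicity of a module with local endomorphism ring -/

section Multiplicity

variable {Λ : Type u} [Ring Λ]

theorem isUnit_or_isUnit_of_add {X : Type u} [AddCommGroup X] [Module Λ X]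
    (hX : ∀ a : Module.End Λ X, IsUnit a ∨ IsUnit (1 - a)) {a b : Module.End Λ X}
    (h : IsUnit (a + b)) : IsUnit a ∨ IsUnit b := by
  obtain ⟨w, hw⟩ := h
  -- Multiplying by `w⁻¹` normalises the sum to `1`, where locality applies directly.
  have key : ∀ c : Module.End Λ X, IsUnit ((↑w⁻¹ : Module.End Λ X) * c) → IsUnit c := by
    intro c hc
    have := w.isUnit.mul hc
    rwa [← mul_assoc, Units.mul_inv, one_mul] at this
  have h1 : (1 : Module.End Λ X) - ↑w⁻¹ * a = ↑w⁻¹ * b := by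
    rw [← Units.inv_mul w, hw, mul_add, add_sub_cancel_left]
  rcases hX (↑w⁻¹ * a) with h | h
  · exact Or.inl (key a h)
  · rw [h1] at h
    exact Or.inr (key b h)

/-- `X` has a local endomorphism ring. -/
class HasLocalEnd (X : FGModuleCat.{u} Λ) : Prop where
  nontrivial : Nontrivial X
  isUnit_or : ∀ a : Module.End Λ X, IsUnit a ∨ IsUnit (1 - a)
  -- Used in `mult_self`; for indecomposable modules over an artinian ring it comes from
  -- noetherianity.
  isUnit_of_surjective : ∀ a : Module.End Λ X, Function.Surjective a → IsUnit a

/-- The radical maps `M → X`: those whose composition with every map `X → M` is a nonunit. -/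
def radHom (X M : FGModuleCat.{u} Λ) [hX : HasLocalEnd X] :
    Submodule (Module.End Λ X) (M →ₗ[Λ] X) where
  carrier := {g | ∀ f : X →ₗ[Λ] M, ¬ IsUnit (g ∘ₗ f : Module.End Λ X)}
  zero_mem' := by
    intro f h
    have := hX.nontrivial
    rw [LinearMap.zero_comp] at h
    exact not_isUnit_zero h
  add_mem' := by
    intro a b ha hb f h
    rw [LinearMap.add_comp] at h
    exact (isUnit_or_isUnit_of_add hX.isUnit_or h).elim (ha f) (hb f)
  smul_mem' := by
    intro s g hg f h
    obtain ⟨w, hw⟩ := h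
    -- `e = g ∘ f ∘ w⁻¹ ∘ s` satisfies `s * (1 - e) = 0`, so `1 - e` is not a unit
    let e : Module.End Λ X := g ∘ₗ (f ∘ₗ ((↑w⁻¹ : Module.End Λ X) ∘ₗ s))
    have hse : ∀ x, s (e x) = s x := by
      intro x
      have h1 : (w : Module.End Λ X) ((↑w⁻¹ : Module.End Λ X) (s x)) = s x := by
        rw [← Module.End.mul_apply, Units.mul_inv, Module.End.one_apply]
      rw [hw] at h1
      exact h1
    rcases hX.isUnit_or e with h | h
    · exact hg _ h
    · have hs : s = 0 := by
        have h2 : s * (1 - e) = 0 := by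
          ext x
          simp [Module.End.mul_apply, hse]
        obtain ⟨v, hv⟩ := h
        rw [← hv] at h2
        exact v.mul_left_eq_zero.1 h2
      have := hX.nontrivial
      apply w.ne_zero
      rw [hw, hs]
      ext x
      rfl

theorem mem_radHom {X M : FGModuleCat.{u} Λ} [HasLocalEnd X] {g : M →ₗ[Λ] X} :
    g ∈ radHom X M ↔ ∀ f : X →ₗ[Λ] M, ¬ IsUnit (g ∘ₗ f : Module.End Λ X) := Iff.rfl

/-- The number of summands isomorphic to `X` in a decomposition of `M` into indecomposables. -/
noncomputable def mult (X M : FGModuleCat.{u} Λ) [HasLocalEnd X] : ℕ∞ :=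
  Module.length (Module.End Λ X) ((M →ₗ[Λ] X) ⧸ radHom X M)

theorem comp_mem_radHom {X M N : FGModuleCat.{u} Λ} [HasLocalEnd X] {g : M →ₗ[Λ] X}
    (hg : g ∈ radHom X M) (h : N →ₗ[Λ] M) : g ∘ₗ h ∈ radHom X N :=
  fun f => hg (h ∘ₗ f)

/-- `Hom(M, X)` splits as `Hom(A, X) × Hom(B, X)`, and the radical splits along with it because it
is closed under addition and precomposition. -/
theorem mult_prod {X M A B : FGModuleCat.{u} Λ} [hX : HasLocalEnd X] (e : M ≃ₗ[Λ] (A × B)) :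
    mult X M = mult X A + mult X B := by
  let iA : A →ₗ[Λ] M := e.symm.toLinearMap ∘ₗ LinearMap.inl Λ A B
  let iB : B →ₗ[Λ] M := e.symm.toLinearMap ∘ₗ LinearMap.inr Λ A B
  let pA : M →ₗ[Λ] A := LinearMap.fst Λ A B ∘ₗ e.toLinearMap
  let pB : M →ₗ[Λ] B := LinearMap.snd Λ A B ∘ₗ e.toLinearMap
  let restr {N N' : FGModuleCat.{u} Λ} (h : N →ₗ[Λ] N') :
      (N' →ₗ[Λ] X) →ₗ[Module.End Λ X] (N →ₗ[Λ] X) :=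
    { toFun := fun g => g ∘ₗ h
      map_add' := fun _ _ => rfl
      map_smul' := fun _ _ => rfl }
  let φ : (M →ₗ[Λ] X) →ₗ[Module.End Λ X]
      ((A →ₗ[Λ] X) ⧸ radHom X A) × ((B →ₗ[Λ] X) ⧸ radHom X B) :=
    ((radHom X A).mkQ ∘ₗ restr iA).prod ((radHom X B).mkQ ∘ₗ restr iB)
  have hφ : Function.Surjective φ := by
    rintro ⟨a, b⟩
    obtain ⟨a, rfl⟩ := Submodule.mkQ_surjective _ a
    obtain ⟨b, rfl⟩ := Submodule.mkQ_surjective _ b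
    have hA : (a ∘ₗ pA + b ∘ₗ pB) ∘ₗ iA = a := by
      ext x
      simp [pA, pB, iA]
    have hB : (a ∘ₗ pA + b ∘ₗ pB) ∘ₗ iB = b := by
      ext x
      simp [pA, pB, iB]
    exact ⟨a ∘ₗ pA + b ∘ₗ pB, Prod.ext (congrArg (radHom X A).mkQ hA)
      (congrArg (radHom X B).mkQ hB)⟩
  have hker : LinearMap.ker φ = radHom X M := by
    ext g
    have h1 : g ∈ LinearMap.ker φ ↔ g ∘ₗ iA ∈ radHom X A ∧ g ∘ₗ iB ∈ radHom X B := by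
      rw [← Submodule.Quotient.mk_eq_zero (radHom X A),
        ← Submodule.Quotient.mk_eq_zero (radHom X B)]
      exact Prod.mk_eq_zero
    rw [h1]
    refine ⟨fun h => ?_, fun h => ⟨comp_mem_radHom h _, comp_mem_radHom h _⟩⟩
    have hg : g = (g ∘ₗ iA) ∘ₗ pA + (g ∘ₗ iB) ∘ₗ pB := by
      ext x
      have : x = iA (pA x) + iB (pB x) := by
        apply e.injective
        simp [iA, iB, pA, pB]
      conv_lhs => rw [this]
      simp
    rw [hg]
    exact add_mem (comp_mem_radHom h.1 _) (comp_mem_radHom h.2 _)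
  rw [mult, ← hker, (φ.quotKerEquivOfSurjective hφ).length_eq, Module.length_prod]
  rfl

/-- The radical is a maximal left ideal of `End X`: an endomorphism outside it is surjective, hence
a unit, and generates everything. -/
theorem mult_self (X : FGModuleCat.{u} Λ) [hX : HasLocalEnd X] : mult X X = 1 := by
  rw [mult, Module.length_eq_one_iff, isSimpleModule_iff_isCoatom]
  refine ⟨?_, fun N hN => ?_⟩
  · intro h
    have hid : (LinearMap.id : X →ₗ[Λ] X) ∈ radHom X X := h ▸ Submodule.mem_top
    exact hid LinearMap.id isUnit_one
  · obtain ⟨g, hgN, hg⟩ := SetLike.exists_of_lt hN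
    rw [mem_radHom] at hg
    push Not at hg
    obtain ⟨f, hf⟩ := hg
    have hsurj : Function.Surjective g := by
      have := ((Module.End.isUnit_iff _).1 hf).2
      exact Function.Surjective.of_comp this
    obtain ⟨w, hw⟩ := hX.isUnit_of_surjective g hsurj
    rw [eq_top_iff]
    intro k _
    have : k = ((k : Module.End Λ X) * (↑w⁻¹ : Module.End Λ X)) • (g : X →ₗ[Λ] X) := by
      change (k : Module.End Λ X) = (k * ↑w⁻¹) * g
      rw [← hw, mul_assoc, Units.inv_mul, mul_one]
    rw [this]
    exact N.smul_mem _ hgN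

/-- A nonradical `g : Y → X` comes with an `f` such that `g ∘ f` is invertible, so `X` splits off
`Y` and indecomposability makes the complement zero. -/
theorem equiv_of_mult_ne_zero {X Y : FGModuleCat.{u} Λ} [hX : HasLocalEnd X]
    (hY : IsIndecomposable Y) (h : mult X Y ≠ 0) : Nonempty (X ≃ₗ[Λ] Y) := by
  have h1 : radHom X Y ≠ ⊤ := fun ht => h (Module.length_eq_zero_iff.2
    (Submodule.Quotient.subsingleton_iff.2 ht))
  obtain ⟨g, hg⟩ := SetLike.exists_not_mem_of_ne_top _ h1 rfl
  rw [mem_radHom] at hg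
  push Not at hg
  obtain ⟨f, w, hw⟩ := hg
  let r : Y →ₗ[Λ] X := (↑w⁻¹ : Module.End Λ X) ∘ₗ g
  have hr : ∀ x, r (f x) = x := by
    intro x
    have : (↑w⁻¹ : Module.End Λ X) ((g ∘ₗ f) x) = x := by
      rw [← hw, ← Module.End.mul_apply, Units.inv_mul, Module.End.one_apply]
    exact this
  -- The kernel is the image of `Y` under `id - f ∘ r`, so it is finitely generated without a
  -- noetherian assumption on `Λ`.
  have hfin : Module.Finite Λ (LinearMap.ker r) := by
    let q : Y →ₗ[Λ] LinearMap.ker r := (LinearMap.id - f ∘ₗ r).codRestrict _ fun y => by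
      simp [hr]
    refine Module.Finite.of_surjective q fun y => ⟨y, Subtype.ext ?_⟩
    have : r y = 0 := y.2
    simp [q, this]
  let e : Y ≃ₗ[Λ] (X × FGModuleCat.of Λ (LinearMap.ker r)) :=
    { toFun := fun y => (r y, ⟨y - f (r y), by simp [hr]⟩)
      invFun := fun z => f z.1 + z.2.1
      map_add' := fun a b => by
        refine Prod.ext (map_add _ _ _) (Subtype.ext ?_)
        change a + b - f (r (a + b)) = (a - f (r a)) + (b - f (r b))
        rw [map_add, map_add]
        abel
      map_smul' := fun c a => by
        refine Prod.ext (map_smul _ _ _) (Subtype.ext ?_)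
        simp [smul_sub]
      left_inv := fun y => by simp
      right_inv := fun z => by
        have hz : r z.2.1 = 0 := z.2.2
        refine Prod.ext ?_ (Subtype.ext ?_)
        · simp [hr, hz]
        · simp [hr, hz] }
  have := hX.nontrivial
  rcases hY.2 _ _ ⟨e⟩ with h | h
  · exact absurd h (not_subsingleton X)
  · exact ⟨LinearEquiv.symm (e.trans (LinearEquiv.ofBijective (LinearMap.fst Λ X _)
      ⟨fun a b hab => Prod.ext hab (Subsingleton.elim _ _), fun x => ⟨(x, 0), rfl⟩⟩))⟩

theorem mult_of_subsingleton (X M : FGModuleCat.{u} Λ) [HasLocalEnd X] (h : Subsingleton M) :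
    mult X M = 0 := by
  have h1 : ∀ g g' : M →ₗ[Λ] X, g = g' := fun g g' => by
    ext x
    rw [Subsingleton.elim x 0, map_zero, map_zero]
  have : Subsingleton (M →ₗ[Λ] X) := ⟨h1⟩
  exact Module.length_eq_zero_iff.2 inferInstance

theorem isSummand_trans {A B C : FGModuleCat.{u} Λ} (h : IsSummand A B) (h' : IsSummand B C) :
    IsSummand A C := by
  obtain ⟨X, ⟨e⟩⟩ := h
  obtain ⟨Y, ⟨e'⟩⟩ := h'
  exact ⟨FGModuleCat.of Λ (X × Y), ⟨(e'.trans (e.prodCongr (LinearEquiv.refl Λ Y))).trans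
    (LinearEquiv.prodAssoc Λ A X Y)⟩⟩

theorem isSummand_of_equiv {A B : FGModuleCat.{u} Λ} (e : B ≃ₗ[Λ] A) : IsSummand A B :=
  ⟨FGModuleCat.of Λ PUnit.{u + 1}, ⟨e.trans (LinearEquiv.prodUnique (R := Λ) (M := A)
    (M₂ := PUnit.{u + 1})).symm⟩⟩

theorem mult_ne_zero_of_isSummand {X M : FGModuleCat.{u} Λ} [HasLocalEnd X]
    (h : IsSummand X M) : mult X M ≠ 0 := by
  obtain ⟨Y, ⟨e⟩⟩ := h
  rw [mult_prod e, mult_self]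
  simp

theorem mult_fin_fun_eq_zero {X M : FGModuleCat.{u} Λ} [HasLocalEnd X] (h : mult X M = 0)
    (n : ℕ) : mult X (FGModuleCat.of Λ (Fin n → M)) = 0 := by
  induction n with
  | zero => exact mult_of_subsingleton X _ (inferInstanceAs (Subsingleton (Fin 0 → M)))
  | succ n ih =>
    have : mult X (FGModuleCat.of Λ (Fin (n + 1) → M)) =
        mult X M + mult X (FGModuleCat.of Λ (Fin n → M)) :=
      mult_prod (Fin.consLinearEquiv Λ fun _ : Fin (n + 1) => M).symm
    rw [this, h, ih, add_zero]

theorem mem_addClosure_of_isSummand {X M : FGModuleCat.{u} Λ} (h : IsSummand X M) :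
    X ∈ addClosure M :=
  ⟨1, isSummand_trans h (isSummand_of_equiv (LinearEquiv.funUnique (Fin 1) Λ M))⟩

theorem projective_of_isSummand {Z P : FGModuleCat.{u} Λ} (h : IsSummand Z P)
    (hP : Module.Projective Λ P) : Module.Projective Λ Z := by
  obtain ⟨s, r, hrs⟩ := h.exists_retract
  exact Module.Projective.of_split s r hrs

end Multiplicity

/-! ### Krull–Schmidt over an artinian ring -/

section Decomposition

variable {Λ : Type u} [Ring Λ] [IsArtinianRing Λ]

/-- Fitting decomposition `X = ker a^k ⊕ im a^k`: one summand is zero, so `a` is either invertible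
or nilpotent, and in the latter case `1 - a` is invertible. -/
theorem IsIndecomposable.hasLocalEnd {X : FGModuleCat.{u} Λ} (h : IsIndecomposable X) :
    HasLocalEnd X := by
  have hsurj : ∀ a : Module.End Λ X, Function.Surjective a → IsUnit a := fun a ha =>
    (Module.End.isUnit_iff a).2 (IsNoetherian.bijective_of_surjective_endomorphism a ha)
  refine ⟨h.1, fun a => ?_, hsurj⟩
  obtain ⟨k, hk, hk1⟩ := ((LinearMap.eventually_isCompl_ker_pow_range_pow a).and
    (Filter.eventually_ge_atTop 1)).exists
  let e : X ≃ₗ[Λ] (FGModuleCat.of Λ (LinearMap.ker (a ^ k)) ×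
      FGModuleCat.of Λ (LinearMap.range (a ^ k))) :=
    (Submodule.prodEquivOfIsCompl _ _ hk).symm
  rcases h.2 _ _ ⟨e⟩ with h | h
  · left
    have hker : LinearMap.ker (a ^ k) = ⊥ := (Submodule.subsingleton_iff_eq_bot).1 h
    have hrange : LinearMap.range (a ^ k) = ⊤ := by
      have := hk.sup_eq_top
      rwa [hker, bot_sup_eq] at this
    refine (isUnit_pow_iff (by omega : k ≠ 0)).1 ((Module.End.isUnit_iff _).2
      ⟨LinearMap.ker_eq_bot.1 hker, LinearMap.range_eq_top.1 hrange⟩)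
  · right
    have hrange : LinearMap.range (a ^ k) = ⊥ := (Submodule.subsingleton_iff_eq_bot).1 h
    exact IsNilpotent.isUnit_one_sub ⟨k, LinearMap.range_eq_bot.1 hrange⟩

/-- Induction over decompositions of a finitely generated module. -/
theorem decomposition_induction {p : FGModuleCat.{u} Λ → Prop}
    (zero : ∀ M : FGModuleCat.{u} Λ, Subsingleton M → p M)
    (indec : ∀ M, IsIndecomposable M → p M)
    (prod : ∀ M X Y : FGModuleCat.{u} Λ, (M ≃ₗ[Λ] (X × Y)) → p X → p Y → p M)
    (M : FGModuleCat.{u} Λ) : p M := by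
  -- Induction on length: both factors of a nontrivial decomposition are strictly shorter.
  suffices H : ∀ (n : ℕ) (M : FGModuleCat.{u} Λ), Module.length Λ M = n → p M by
    obtain ⟨n, hn⟩ := ENat.ne_top_iff_exists.1 (Module.length_ne_top (R := Λ) (M := M))
    exact H n M hn.symm
  intro n
  induction n using Nat.strong_induction_on with
  | _ n ih =>
  intro M hM
  rcases subsingleton_or_nontrivial M with h | h
  · exact zero M h
  by_cases hi : IsIndecomposable M
  · exact indec M hi
  have : ∃ X Y : FGModuleCat.{u} Λ, Nonempty (M ≃ₗ[Λ] (X × Y)) ∧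
      ¬ Subsingleton X ∧ ¬ Subsingleton Y := by
    by_contra hne
    push Not at hne
    exact hi ⟨h, fun X Y he => or_iff_not_imp_left.2 fun hX =>
      hne X Y he (not_subsingleton_iff_nontrivial.1 hX)⟩
  obtain ⟨X, Y, ⟨e⟩, hX, hY⟩ := this
  obtain ⟨a, ha⟩ := ENat.ne_top_iff_exists.1 (Module.length_ne_top (R := Λ) (M := X))
  obtain ⟨b, hb⟩ := ENat.ne_top_iff_exists.1 (Module.length_ne_top (R := Λ) (M := Y))
  have hab : a + b = n := by
    have := e.length_eq
    rw [Module.length_prod, hM, ← ha, ← hb] at this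
    exact_mod_cast this.symm
  have ha0 : a ≠ 0 := fun h0 => hX (Module.length_eq_zero_iff.1 (by rw [← ha, h0]; rfl))
  have hb0 : b ≠ 0 := fun h0 => hY (Module.length_eq_zero_iff.1 (by rw [← hb, h0]; rfl))
  exact prod M X Y e (ih a (by omega) X ha.symm) (ih b (by omega) Y hb.symm)

theorem mult_ne_top (X M : FGModuleCat.{u} Λ) [HasLocalEnd X] : mult X M ≠ ⊤ := by
  induction M using decomposition_induction with
  | zero M h => rw [mult_of_subsingleton X M h]; exact ENat.zero_ne_top
  | indec M h =>
    by_cases h0 : mult X M = 0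
    · rw [h0]
      exact ENat.zero_ne_top
    · obtain ⟨e⟩ := equiv_of_mult_ne_zero h h0
      have he : mult X M = mult X X + mult X (FGModuleCat.of Λ PUnit.{u + 1}) :=
        mult_prod (e.symm.trans (LinearEquiv.prodUnique (R := Λ) (M := X)
          (M₂ := PUnit.{u + 1})).symm)
      rw [he, mult_self, mult_of_subsingleton X (FGModuleCat.of Λ PUnit.{u + 1})
        (inferInstanceAs (Subsingleton PUnit.{u + 1}))]
      exact ENat.natCast_ne_top 1
  | prod M A B e hA hB =>
    rw [mult_prod e]
    exact WithTop.add_ne_top.2 ⟨hA, hB⟩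

/-- Over an artinian ring, `mult X` is an additive function on the split Grothendieck group. -/
noncomputable def multHom (X : FGModuleCat.{u} Λ) [HasLocalEnd X] : SplitK Λ →+ ℤ :=
  QuotientAddGroup.lift (splitRelations Λ)
    (FreeAbelianGroup.lift fun M : FGModuleCat.{u} Λ => ((mult X M).toNat : ℤ)) (by
      refine (AddSubgroup.closure_le _).2 ?_
      rintro _ ⟨M, A, B, ⟨e⟩, rfl⟩
      change FreeAbelianGroup.lift _ _ = 0
      rw [map_sub, map_sub, FreeAbelianGroup.lift_apply_of, FreeAbelianGroup.lift_apply_of,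
        FreeAbelianGroup.lift_apply_of, mult_prod e,
        ENat.toNat_add (mult_ne_top X A) (mult_ne_top X B)]
      push_cast
      abel)

theorem multHom_cls (X M : FGModuleCat.{u} Λ) [HasLocalEnd X] :
    multHom X (cls M) = ((mult X M).toNat : ℤ) :=
  FreeAbelianGroup.lift_apply_of _ _

theorem multHom_cls_eq_zero_iff {X M : FGModuleCat.{u} Λ} [HasLocalEnd X] :
    multHom X (cls M) = 0 ↔ mult X M = 0 := by
  rw [multHom_cls, Nat.cast_eq_zero, ENat.toNat_eq_zero, or_iff_left (mult_ne_top X M)]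

/-- Every finitely generated module is a finite direct sum of indecomposable modules. -/
theorem exists_list_indecomposable (M : FGModuleCat.{u} Λ) : ∃ l : List (FGModuleCat.{u} Λ),
    (∀ X ∈ l, IsIndecomposable X ∧ IsSummand X M) ∧ cls M = (l.map cls).sum := by
  induction M using decomposition_induction with
  | zero M h => exact ⟨[], by simp, by simpa using cls_eq_zero M⟩
  | indec M h =>
    refine ⟨[M], fun X hX => ?_, by simp⟩
    rw [List.mem_singleton] at hX
    subst hX
    exact ⟨h, isSummand_of_equiv (LinearEquiv.refl Λ _)⟩
  | prod M A B e hA hB =>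
    obtain ⟨l, hl, hlA⟩ := hA
    obtain ⟨l', hl', hlB⟩ := hB
    refine ⟨l ++ l', fun X hX => ?_, by rw [cls_eq_add ⟨e⟩, hlA, hlB]; simp⟩
    rcases List.mem_append.1 hX with h | h
    · exact ⟨(hl X h).1, isSummand_trans (hl X h).2 ⟨B, ⟨e⟩⟩⟩
    · exact ⟨(hl' X h).1, isSummand_trans (hl' X h).2
        ⟨A, ⟨e.trans (LinearEquiv.prodComm Λ A B)⟩⟩⟩

/-- Otherwise the additive function `multHom X` would vanish on every term of the sum. -/
theorem exists_equiv_of_mult_ne_zero {X M : FGModuleCat.{u} Λ} [HasLocalEnd X]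
    {l : List (FGModuleCat.{u} Λ)} (hl : ∀ Y ∈ l, IsIndecomposable Y)
    (hM : cls M = (l.map cls).sum) (h : mult X M ≠ 0) : ∃ Y ∈ l, Nonempty (X ≃ₗ[Λ] Y) := by
  by_contra! hne
  apply h
  rw [← multHom_cls_eq_zero_iff, hM, map_list_sum, List.map_map]
  refine List.sum_eq_zero fun z hz => ?_
  obtain ⟨Y, hY, rfl⟩ := List.mem_map.1 hz
  refine multHom_cls_eq_zero_iff.2 ?_
  by_contra h0
  exact (not_nonempty_iff.2 (hne Y hY)) (equiv_of_mult_ne_zero (hl Y hY) h0)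

/-- Up to isomorphism, `add M` has only the indecomposables of a decomposition of `M`. -/
theorem exists_equiv_of_mem_addClosure {X M : FGModuleCat.{u} Λ} (hX : IsIndecomposable X)
    (h : X ∈ addClosure M) {l : List (FGModuleCat.{u} Λ)} (hl : ∀ Y ∈ l, IsIndecomposable Y)
    (hM : cls M = (l.map cls).sum) : ∃ Y ∈ l, Nonempty (X ≃ₗ[Λ] Y) := by
  have := hX.hasLocalEnd
  obtain ⟨n, hn⟩ := h
  exact exists_equiv_of_mult_ne_zero hl hM fun h0 =>
    mult_ne_zero_of_isSummand hn (mult_fin_fun_eq_zero h0 n)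

theorem isSummand_of_mem_addClosure {X M : FGModuleCat.{u} Λ} (hX : IsIndecomposable X)
    (h : X ∈ addClosure M) : IsSummand X M := by
  obtain ⟨l, hl, hM⟩ := exists_list_indecomposable M
  obtain ⟨Y, hY, ⟨e⟩⟩ := exists_equiv_of_mem_addClosure hX h (fun Y hY => (hl Y hY).1) hM
  exact isSummand_trans (isSummand_of_equiv e.symm) (hl Y hY).2

/-- A module whose class vanishes modulo the projectives is projective. -/
theorem projective_of_cls_mem {M : FGModuleCat.{u} Λ}
    (h : cls M ∈ spanClass (projectives Λ)) : Module.Projective Λ M := by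
  -- For nonprojective `X`, `multHom X` kills all of `⟨𝒫⟩`. Unlike `h`, this vanishing visibly
  -- passes to summands of `M`, so it serves as the induction hypothesis.
  have h1 : ∀ (X : FGModuleCat.{u} Λ) [HasLocalEnd X], ¬ Module.Projective Λ X →
      mult X M = 0 := by
    intro X _ hX
    rw [← multHom_cls_eq_zero_iff]
    have hle : spanClass (projectives Λ) ≤ (multHom X).ker := by
      refine (AddSubgroup.closure_le _).2 ?_
      rintro _ ⟨Y, hY, hYp, rfl⟩
      have hYp' : Module.Projective Λ Y := hYp.elim (fun h => h) (fun h => h)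
      refine multHom_cls_eq_zero_iff.2 ?_
      by_contra h0
      obtain ⟨e⟩ := equiv_of_mult_ne_zero hY h0
      exact hX (Module.Projective.of_equiv e.symm)
    exact hle h
  clear h
  induction M using decomposition_induction with
  | zero M h => infer_instance
  | indec M h =>
    have := h.hasLocalEnd
    by_contra hM
    have := h1 M hM
    rw [mult_self] at this
    exact one_ne_zero this
  | prod M A B e hA hB =>
    have := hA fun X _ hX => by
      have := h1 X hX
      rw [mult_prod e] at this
      exact (add_eq_zero.1 this).1
    have := hB fun X _ hX => by
      have := h1 X hX
      rw [mult_prod e] at this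
      exact (add_eq_zero.1 this).2
    exact Module.Projective.of_equiv e.symm

end Decomposition

/-! ### Fitting numbers of finitely generated subgroups -/

section Fitting

variable {G : Type v} [AddCommGroup G] (f : G →+ G)

/-- Fitting's lemma: on a finitely generated subgroup the kernels of the iterates stabilize. -/
theorem exists_forall_bijOn {X : AddSubgroup G} {s : Set G} (hs : s.Finite)
    (hX : X ≤ AddSubgroup.closure s) : ∃ k : ℕ, ∀ m : ℕ, k ≤ m →
      Set.BijOn f (f^[m] '' (X : Set G)) (f^[m + 1] '' (X : Set G)) := by
  let N : Submodule ℤ G := Submodule.span ℤ s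
  have hXN : ∀ x ∈ X, x ∈ N := by
    intro x hx
    have h1 : AddSubgroup.closure s ≤ N.toAddSubgroup :=
      (AddSubgroup.closure_le _).2 Submodule.subset_span
    exact h1 (hX hx)
  have hN : IsNoetherian ℤ N :=
    have := Module.Finite.span_of_finite ℤ hs
    inferInstanceAs (IsNoetherian ℤ (Submodule.span ℤ s))
  let g : Module.End ℤ G := f.toIntLinearMap
  -- The kernels of the iterates on `X`, viewed inside the noetherian module `N`, where the chain
  -- must stabilise.
  let K : ℕ →o Submodule ℤ N :=
    ⟨fun m => (LinearMap.ker (g ^ m) ⊓ X.toIntSubmodule).comap N.subtype, fun a b hab =>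
      Submodule.comap_mono (inf_le_inf_right _ (g.iterateKer.monotone hab))⟩
  obtain ⟨k, hk⟩ := monotone_stabilizes_iff_noetherian.2 hN K
  have hpow : ∀ (m : ℕ) (x : G), (g ^ m) x = f^[m] x := fun m x => Module.End.pow_apply g m x
  refine ⟨k, fun m hm => ⟨?_, ?_, ?_⟩⟩
  · rintro _ ⟨x, hx, rfl⟩
    exact ⟨x, hx, Function.iterate_succ_apply' f m x⟩
  · rintro _ ⟨x, hx, rfl⟩ _ ⟨y, hy, rfl⟩ hxy
    have hz : x - y ∈ X := sub_mem hx hy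
    have h1 : (⟨x - y, hXN _ hz⟩ : N) ∈ K (m + 1) := by
      refine ⟨?_, hz⟩
      change (g ^ (m + 1)) (x - y) = 0
      rw [map_sub, hpow, hpow, Function.iterate_succ_apply', Function.iterate_succ_apply', hxy,
        sub_self]
    rw [← hk (m + 1) (by omega), hk m hm] at h1
    have h2 : (g ^ m) (x - y) = 0 := h1.1
    rwa [map_sub, hpow, hpow, sub_eq_zero] at h2
  · rintro _ ⟨x, hx, rfl⟩
    exact ⟨f^[m] x, ⟨x, hx, rfl⟩, (Function.iterate_succ_apply' f m x).symm⟩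

/-- An infimum in `ℕ` is attained only over a nonempty set (over the empty set it defaults to `0`);
Fitting's lemma provides nonemptiness. -/
theorem injOn_of_fittingNumber_le {X : AddSubgroup G} {s : Set G} (hs : s.Finite)
    (hX : X ≤ AddSubgroup.closure s) {m : ℕ} (hm : fittingNumber f X ≤ m) :
    Set.InjOn f (f^[m] '' (X : Set G)) :=
  (Nat.sInf_mem (exists_forall_bijOn f hs hX) m hm).injOn

/-- Surjectivity onto the next image is automatic, so only injectivity has to be checked. -/
theorem fittingNumber_le {X : AddSubgroup G} {k : ℕ}
    (h : ∀ m, k ≤ m → Set.InjOn f (f^[m] '' (X : Set G))) : fittingNumber f X ≤ k := by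
  refine Nat.sInf_le fun m hm => ⟨?_, h m hm, ?_⟩
  · rintro _ ⟨x, hx, rfl⟩
    exact ⟨x, hx, Function.iterate_succ_apply' f m x⟩
  · rintro _ ⟨x, hx, rfl⟩
    exact ⟨f^[m] x, ⟨x, hx, rfl⟩, (Function.iterate_succ_apply' f m x).symm⟩

end Fitting

/-! ### Bounds for `Phi` and `Psi`: parts (b) and (c) -/

section PhiBounds

variable {Λ : Type u} [Ring Λ] [IsArtinianRing Λ]

/-- The class of `M` in `K/⟨𝒫⟩`. -/
noncomputable def stableCls (M : FGModuleCat.{u} Λ) : StableK Λ :=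
  QuotientAddGroup.mk' (spanClass (projectives Λ)) (cls M)

/-- The subgroup of `K/⟨𝒫⟩` generated by the indecomposables in `add M`. -/
noncomputable def stableSpan (M : FGModuleCat.{u} Λ) : AddSubgroup (StableK Λ) :=
  (spanClass (addClosure M)).map (QuotientAddGroup.mk' (spanClass (projectives Λ)))

theorem stableSyzygyHom_stableCls (M : FGModuleCat.{u} Λ) :
    stableSyzygyHom Λ (stableCls M) = stableCls (syzygy M) :=
  congrArg (QuotientAddGroup.mk' (spanClass (projectives Λ))) (syzygyHom_cls Λ M)

theorem iterate_stableSyzygyHom_stableCls (n : ℕ) (M : FGModuleCat.{u} Λ) :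
    (stableSyzygyHom Λ)^[n] (stableCls M) = stableCls (syzygy^[n] M) := by
  induction n generalizing M with
  | zero => rfl
  | succ n ih => rw [Function.iterate_succ_apply, stableSyzygyHom_stableCls, ih,
      Function.iterate_succ_apply]

theorem stableCls_eq_zero_iff {M : FGModuleCat.{u} Λ} :
    stableCls M = 0 ↔ Module.Projective Λ M := by
  have h0 : stableCls M = 0 ↔ cls M ∈ spanClass (projectives Λ) :=
    QuotientAddGroup.eq_zero_iff _
  rw [h0]
  refine ⟨projective_of_cls_mem, fun hM => ?_⟩
  obtain ⟨l, hl, hlM⟩ := exists_list_indecomposable M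
  rw [hlM]
  refine list_sum_mem fun z hz => ?_
  obtain ⟨X, hX, rfl⟩ := List.mem_map.1 hz
  exact AddSubgroup.subset_closure
    ⟨X, (hl X hX).1, Or.inr (projective_of_isSummand (hl X hX).2 hM), rfl⟩

/-- The projective generators admitted by `spanClass` die in the quotient, leaving only those in
`addClosure M`. -/
theorem stableSpan_le {M : FGModuleCat.{u} Λ} {H : AddSubgroup (StableK Λ)}
    (h : ∀ X, IsIndecomposable X → X ∈ addClosure M → stableCls X ∈ H) : stableSpan M ≤ H := by
  rw [stableSpan, AddSubgroup.map_le_iff_le_comap]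
  refine (AddSubgroup.closure_le _).2 ?_
  rintro _ ⟨X, hX, hX' | hX', rfl⟩
  · exact h X hX hX'
  · change stableCls X ∈ H
    rw [stableCls_eq_zero_iff.2 hX']
    exact zero_mem H

theorem stableCls_mem_stableSpan {N M : FGModuleCat.{u} Λ} (h : IsSummand N M) :
    stableCls N ∈ stableSpan M := by
  obtain ⟨l, hl, hlN⟩ := exists_list_indecomposable N
  refine AddSubgroup.mem_map_of_mem _ ?_
  rw [hlN]
  refine list_sum_mem fun z hz => ?_
  obtain ⟨X, hX, rfl⟩ := List.mem_map.1 hz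
  exact AddSubgroup.subset_closure ⟨X, (hl X hX).1,
    Or.inl (mem_addClosure_of_isSummand (isSummand_trans (hl X hX).2 h)), rfl⟩

/-- By Krull–Schmidt, `add M` has finitely many indecomposables up to isomorphism. -/
theorem exists_finite_stableSpan_le (M : FGModuleCat.{u} Λ) :
    ∃ s : Set (StableK Λ), s.Finite ∧ stableSpan M ≤ AddSubgroup.closure s := by
  obtain ⟨l, hl, hM⟩ := exists_list_indecomposable M
  refine ⟨stableCls '' {X | X ∈ l}, l.finite_toSet.image _, stableSpan_le fun X hX hXM => ?_⟩
  obtain ⟨Y, hY, ⟨e⟩⟩ := exists_equiv_of_mem_addClosure hX hXM (fun Y hY => (hl Y hY).1) hM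
  refine AddSubgroup.subset_closure ⟨Y, hY, ?_⟩
  rw [stableCls, stableCls, cls_eq_of_equiv e]

theorem stableSpan_map_le (M : FGModuleCat.{u} Λ) :
    stableSpan M ≤ (stableSpan (syzygy M)).comap (stableSyzygyHom Λ) :=
  stableSpan_le fun X hX hXM => by
    rw [AddSubgroup.mem_comap, stableSyzygyHom_stableCls]
    exact stableCls_mem_stableSpan (isSummand_of_mem_addClosure hX hXM).syzygy

theorem injOn_of_Phi_le {M : FGModuleCat.{u} Λ} {m : ℕ} (hm : Phi M ≤ m) :
    Set.InjOn (stableSyzygyHom Λ)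
      ((stableSyzygyHom Λ)^[m] '' (stableSpan M : Set (StableK Λ))) := by
  obtain ⟨s, hs, hM⟩ := exists_finite_stableSpan_le M
  exact injOn_of_fittingNumber_le _ hs hM hm

/-- `L^(i+1)⟨add M⟩ ⊆ L^i⟨add ΩM⟩`, and `L` is injective on the latter once `i ≥ Φ(ΩM)`. -/
theorem Phi_le_Phi_syzygy_add_one (M : FGModuleCat.{u} Λ) : Phi M ≤ Phi (syzygy M) + 1 := by
  refine fittingNumber_le _ fun m hm => ?_
  obtain ⟨m, rfl⟩ : ∃ i, m = i + 1 := ⟨m - 1, by omega⟩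
  refine (injOn_of_Phi_le (by omega : Phi (syzygy M) ≤ m)).mono ?_
  rintro _ ⟨x, hx, rfl⟩
  exact ⟨stableSyzygyHom Λ x, stableSpan_map_le M hx, rfl⟩

theorem Phi_le_Phi_iterate_syzygy_add (n : ℕ) (M : FGModuleCat.{u} Λ) :
    Phi M ≤ Phi (syzygy^[n] M) + n := by
  induction n generalizing M with
  | zero => exact le_rfl
  | succ n ih =>
    have h1 := Phi_le_Phi_syzygy_add_one M
    have h2 := ih (syzygy M)
    rw [Function.iterate_succ_apply]
    omega

/-- A finite projective dimension is bounded by `Φ`. -/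
theorem pd_le_Phi {M : FGModuleCat.{u} Λ} (h : pd M < ⊤) : pd M ≤ Phi M := by
  obtain ⟨k, hk⟩ := ENat.ne_top_iff_exists.1 h.ne
  rw [← hk, Nat.cast_le]
  by_contra! hlt
  obtain ⟨j, rfl⟩ : ∃ i, k = i + 1 := ⟨k - 1, by omega⟩
  have hproj := pd_le_iff_projective_syzygy.1 hk.ge
  have hinj := injOn_of_Phi_le (by omega : Phi M ≤ j)
  -- Here `pd M = j + 1`, so `L` sends both `L^j[M]` and `0` to `0`; injectivity on `L^j⟨add M⟩`
  -- identifies them, which gives `pd M ≤ j`.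
  have h0 : stableCls (syzygy^[j] M) = 0 := by
    refine hinj ⟨_, stableCls_mem_stableSpan (isSummand_of_equiv (LinearEquiv.refl Λ M)),
      iterate_stableSyzygyHom_stableCls j M⟩ ⟨0, zero_mem _, iterate_map_zero _ j⟩ ?_
    rw [stableSyzygyHom_stableCls, map_zero, stableCls_eq_zero_iff]
    rwa [Function.iterate_succ_apply'] at hproj
  have hle : pd M ≤ (j : ℕ) := pd_le_iff_projective_syzygy.2 (stableCls_eq_zero_iff.1 h0)
  rw [← hk, Nat.cast_le] at hle
  omega

theorem finDim_le_PhiDim (𝒳 : Set (FGModuleCat.{u} Λ)) : finDim 𝒳 ≤ PhiDim 𝒳 :=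
  iSup₂_le fun X hX => (pd_le_Phi hX.2).trans
    (le_iSup₂ (f := fun (X : FGModuleCat.{u} Λ) (_ : X ∈ 𝒳) => (Phi X : ℕ∞)) X hX.1)

theorem Phi_le_PhiDim {𝒳 : Set (FGModuleCat.{u} Λ)} {X : FGModuleCat.{u} Λ} (hX : X ∈ 𝒳) :
    (Phi X : ℕ∞) ≤ PhiDim 𝒳 :=
  le_iSup₂ (f := fun (X : FGModuleCat.{u} Λ) (_ : X ∈ 𝒳) => (Phi X : ℕ∞)) X hX

theorem PhiDim_le_PsiDim (𝒳 : Set (FGModuleCat.{u} Λ)) : PhiDim 𝒳 ≤ PsiDim 𝒳 :=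
  iSup₂_mono fun _ _ => le_self_add

theorem Phi_le_injDim_add {T : FGModuleCat.{u} Λ} (M : FGModuleCat.{u} Λ) :
    (Phi M : ℕ∞) ≤ injDim T + PhiDim (leftPerp T) := by
  rcases eq_or_ne (injDim T) ⊤ with h | h
  · rw [h, top_add]
    exact le_top
  obtain ⟨n, hn⟩ := ENat.ne_top_iff_exists.1 h
  have hmem : syzygy^[n] M ∈ leftPerp T :=
    iterate_syzygy_mem_leftPerp fun j hj => injDim_le_iff.1 hn.ge j hj M
  rw [← hn, add_comm]
  calc (Phi M : ℕ∞) ≤ ((Phi (syzygy^[n] M) + n : ℕ) : ℕ∞) :=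
        Nat.cast_le.2 (Phi_le_Phi_iterate_syzygy_add n M)
    _ = Phi (syzygy^[n] M) + n := Nat.cast_add _ _
    _ ≤ _ := add_le_add_left (Phi_le_PhiDim hmem) _

theorem Psi_le_injDim {T : FGModuleCat.{u} Λ} (hT : PhiDim (leftPerp T) = 0)
    (M : FGModuleCat.{u} Λ) : Psi M ≤ injDim T := by
  rcases eq_or_ne (injDim T) ⊤ with h | h
  · rw [h]
    exact le_top
  have hPhi := Phi_le_injDim_add (T := T) M
  obtain ⟨n, hn⟩ := ENat.ne_top_iff_exists.1 h
  rw [hT, add_zero, ← hn, Nat.cast_le] at hPhi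
  -- `d` is the part of `injDim T` left over after `Φ(M)`; it bounds the second term of `Psi M`.
  obtain ⟨d, rfl⟩ := Nat.exists_eq_add_of_le hPhi
  have hfin : finDim {Z | IsSummand Z (syzygy^[Phi M] M)} ≤ d := by
    refine iSup₂_le ?_
    rintro Z ⟨hZ, hpd⟩
    rw [pd_le_iff_projective_syzygy]
    -- `Ω^d Z` is a summand of `Ω^(d + Φ(M)) M`, a syzygy of order `injDim T`.
    have hmem : syzygy^[d] Z ∈ leftPerp T := by
      refine leftPerp_of_isSummand (IsSummand.iterate_syzygy hZ d) ?_
      rw [← Function.iterate_add_apply, add_comm]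
      exact iterate_syzygy_mem_leftPerp fun j hj => injDim_le_iff.1 hn.ge j hj M
    obtain ⟨k, hk⟩ := ENat.ne_top_iff_exists.1 hpd.ne
    have hfinite : pd (syzygy^[d] Z) ≤ (k : ℕ) := by
      -- The weaker bound `k + d` lets `Ω^(k+d) Z` be read as `Ω^k (Ω^d Z)` without comparing `k`
      -- and `d`.
      have h1 : pd Z ≤ ((k + d : ℕ) : ℕ∞) := by
        rw [← hk, Nat.cast_le]
        omega
      rw [pd_le_iff_projective_syzygy, Function.iterate_add_apply] at h1
      exact pd_le_iff_projective_syzygy.2 h1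
    refine pd_le_zero_iff.1 ((pd_le_Phi (hfinite.trans_lt (ENat.natCast_lt_top k))).trans ?_)
    exact (Phi_le_PhiDim hmem).trans (by rw [hT]; exact le_rfl)
  rw [← hn, Nat.cast_add]
  exact add_le_add_right hfin _

end PhiBounds

end IgusaTodorov

theorem theorem4 (R : Type v) (Λ : Type u) [CommRing R] [IsArtinianRing R] [Ring Λ] [Algebra R Λ]
    [Module.Finite R Λ] (T : FGModuleCat.{u} Λ) (hT : IsCotilting T) :
    haveI : IsArtinianRing Λ := IsArtinianRing.of_finite R Λ
    injDim T = resDimClass (leftPerp T) Set.univ ∧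
    (finDim (Set.univ : Set (FGModuleCat.{u} Λ)) ≤ PhiDim (Set.univ : Set (FGModuleCat.{u} Λ)) ∧
      PhiDim (Set.univ : Set (FGModuleCat.{u} Λ)) ≤ injDim T + PhiDim (leftPerp T)) ∧
    (PhiDim (leftPerp T) = 0 →
      finDim (Set.univ : Set (FGModuleCat.{u} Λ)) ≤ PhiDim (Set.univ : Set (FGModuleCat.{u} Λ)) ∧
      PhiDim (Set.univ : Set (FGModuleCat.{u} Λ)) ≤ PsiDim (Set.univ : Set (FGModuleCat.{u} Λ)) ∧
      PsiDim (Set.univ : Set (FGModuleCat.{u} Λ)) ≤ injDim T) := by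
  have : IsArtinianRing Λ := IsArtinianRing.of_finite R Λ
  have hle : PhiDim (Set.univ : Set (FGModuleCat.{u} Λ)) ≤ injDim T + PhiDim (leftPerp T) :=
    iSup₂_le fun M _ => Phi_le_injDim_add M
  exact ⟨injDim_eq_resDimClass T, ⟨finDim_le_PhiDim _, hle⟩, fun h =>
    ⟨finDim_le_PhiDim _, PhiDim_le_PsiDim _, iSup₂_le fun M _ => Psi_le_injDim h M⟩⟩
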